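/- **Maximum principle on closed cone surfaces.** A *closed cone surface* $(\mathcal M,(p_1,\dots,p_n),g_0)$ is a nonempty compact (Hausdorff) topological surface $\mathcal M$ with finitely many points $p_1,\dots,p_n\in\mathcal M$ ($n\ge 0$), a smooth structure on $\mathcal M\setminus\{p_1,\dots,p_n\}$ and a smooth Riemannian metric $g_0$ there, such that every $p_i$ has an open neighbourhood $U_i$ containing no other $p_j$, and a homeomorphism $(U_i,p_i)\to(D,0)$ onto an open disc $D\subset\mathbb R^2$ centred at $0$, which is a diffeomorphism from $U_i\setminus\{p_i\}$ onto $D\setminus\{0\}$ and in whose polar coordinates $$g_0=e^{2(a_i+\beta_i\ln r)}\,(dr^2+r^2d\theta^2),\qquad \beta_i=\frac{\alpha_i}{2\pi}-1,$$ with $a_i:D\to\mathbb R$ bounded and continuous on the whole disc and cone angle $\alpha_i\in(0,2\pi]$. Let $T>0$ and let $u:\mathcal M\times[0,T]\to\mathbb R$ be continuous and of class $C^{2,1}(\mathcal M\times(0,T],g_0)$: on $\mathcal M\setminus\{p_1,\dots,p_n\}$ and for times in $(0,T]$, $u$ is $C^2$ in space and $C^1$ in time, and $$\sup|u|+\sup|\nabla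 u|+\sup|\nabla^2u|<\infty,$$ the suprema being over $(\mathcal M\setminus\{p_1,\dots,p_n\})\times(0,T]$ and $\nabla$, the norms taken with respect to $g_0$. Suppose that on $(\mathcal M\setminus\{p_1,\dots,p_n\})\times(0,T]$ $$\frac{\partial u}{\partial t}\le\Delta u,$$ where $\Delta=\operatorname{trace}\nabla^2$ is the Laplacian of $g_0$ (and $\partial u/\partial t$ at $t=T$ is the left derivative). Then the maximum of $u$ over $\mathcal M\times[0,T]$ is attained at time $t=0$: there is $y_0\in\mathcal M$ with $$u(y_0,0)=\max_{\mathcal M\times[0,T]}u .$$ -/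

import Mathlib

open scoped Manifold ContDiff

noncomputable section

namespace ConeMax

/-- The Euclidean plane, the model space of all charts. -/
abbrev Plane : Type := EuclideanSpace ℝ (Fin 2)

/-- The `i`-th standard basis vector of the plane. -/
def stdVec (i : Fin 2) : Plane := EuclideanSpace.single i (1 : ℝ)

/-! ### Riemannian calculus in coordinates

In this section `G` is the matrix field `(g_ij)` of a Riemannian metric in a coordinate domain of the
plane, and `f` is a function in these coordinates. -/

/-- The partial derivative `∂_i f` at `y`. -/
def pd (i : Fin 2) (f : Plane → ℝ) (y : Plane) : ℝ := fderiv ℝ f y (stdVec i)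

/-- The Christoffel symbol `Γ^k_ij` of the Levi-Civita connection,
`½ ∑ₗ g^{kl} (∂_i g_jl + ∂_j g_il - ∂_l g_ij)`. -/
def christoffel (G : Plane → Matrix (Fin 2) (Fin 2) ℝ) (i j k : Fin 2) (y : Plane) : ℝ :=
  (1 / 2) * ∑ l, ((G y)⁻¹ k l) *
    (pd i (fun z => G z j l) y + pd j (fun z => G z i l) y - pd l (fun z => G z i j) y)

/-- The components of the Hessian `∇²f`: `∂_i ∂_j f - ∑ₖ Γ^k_ij ∂_k f`. -/
def coordHess (G : Plane → Matrix (Fin 2) (Fin 2) ℝ) (f : Plane → ℝ) (i j : Fin 2)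
    (y : Plane) : ℝ :=
  pd i (fun z => pd j f z) y - ∑ k, christoffel G i j k y * pd k f y

/-- The Laplacian, the trace of the Hessian: `∑ g^{ij} (∇²f)_ij`. -/
def coordLap (G : Plane → Matrix (Fin 2) (Fin 2) ℝ) (f : Plane → ℝ) (y : Plane) : ℝ :=
  ∑ i, ∑ j, ((G y)⁻¹ i j) * coordHess G f i j y

/-- The norm `|∇f|` with respect to the metric: `(∑ g^{ij} ∂_i f ∂_j f)^{1/2}`. -/
def coordGradNorm (G : Plane → Matrix (Fin 2) (Fin 2) ℝ) (f : Plane → ℝ) (y : Plane) : ℝ :=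
  Real.sqrt (∑ i, ∑ j, ((G y)⁻¹ i j) * (pd i f y * pd j f y))

/-- The norm `|∇²f|` with respect to the metric:
`(∑ g^{ik} g^{jl} (∇²f)_ij (∇²f)_kl)^{1/2}`. -/
def coordHessNorm (G : Plane → Matrix (Fin 2) (Fin 2) ℝ) (f : Plane → ℝ) (y : Plane) : ℝ :=
  Real.sqrt (∑ i, ∑ j, ∑ k, ∑ l,
    ((G y)⁻¹ i k) * ((G y)⁻¹ j l) * (coordHess G f i j y * coordHess G f k l y))

/-! ### Smooth Riemannian surfaces and cone points -/

/-- A smooth Riemannian metric on a smooth surface `X`. -/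
abbrev SmoothMetric (X : Type*) [TopologicalSpace X] [ChartedSpace Plane X]
    [IsManifold (𝓡 2) ∞ X] : Type _ :=
  Bundle.ContMDiffRiemannianMetric (𝓡 2) ∞ Plane (fun x : X => TangentSpace (𝓡 2) x)

/-- The matrix `g_ij = g(∂_i, ∂_j)` of a Riemannian metric `g` in the coordinates of `χ`, as a
function on the target of `χ`; here `∂_i` is the image of the `i`-th standard basis vector under
the differential of `χ⁻¹`. -/
def metricMatrix {X : Type*} [TopologicalSpace X] [ChartedSpace Plane X]
    [IsManifold (𝓡 2) ∞ X] (g : SmoothMetric X) (χ : OpenPartialHomeomorph X Plane)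
    (y : Plane) : Matrix (Fin 2) (Fin 2) ℝ :=
  Matrix.of fun i j =>
    g.inner (χ.symm y)
      ((mfderiv (𝓡 2) (𝓡 2) χ.symm y : Plane →L[ℝ] TangentSpace (𝓡 2) (χ.symm y)) (stdVec i))
      ((mfderiv (𝓡 2) (𝓡 2) χ.symm y : Plane →L[ℝ] TangentSpace (𝓡 2) (χ.symm y)) (stdVec j))

/-- `p` is a cone point, of cone angle `α`, of the topological space `M` whose part
`M ∖ S` is a smooth surface with the smooth Riemannian metric `g`: there is a homeomorphism `κ`
of a neighbourhood of `p` onto an open disc `D` centred at `0`, sending `p` to `0` and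
restricting to a diffeomorphism from the punctured neighbourhood onto `D ∖ {0}` (i.e. to a chart `χ`
of the smooth structure), such that in these coordinates
`g = e^{2(a + β log r)} (dr² + r² dθ²)`, where `β = α / 2π - 1` and `a` is bounded and continuous
on the whole of `D`. -/
def IsConePoint {M : Type*} [TopologicalSpace M] (S : Finset M)
    [ChartedSpace Plane {x : M // x ∉ S}] [IsManifold (𝓡 2) ∞ {x : M // x ∉ S}]
    (g : SmoothMetric {x : M // x ∉ S}) (p : M) (α : ℝ) : Prop :=
  ∃ (ρ : ℝ) (κ : OpenPartialHomeomorph M Plane)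
    (χ : OpenPartialHomeomorph {x : M // x ∉ S} Plane) (a : Plane → ℝ),
    0 < ρ ∧ p ∈ κ.source ∧ κ p = 0 ∧ κ.target = Metric.ball 0 ρ ∧
    (∀ q ∈ κ.source, q ∈ S → q = p) ∧
    χ ∈ IsManifold.maximalAtlas (𝓡 2) ∞ {x : M // x ∉ S} ∧
    χ.source = Subtype.val ⁻¹' κ.source ∧
    (∀ x ∈ χ.source, χ x = κ (x : M)) ∧
    ContinuousOn a (Metric.ball 0 ρ) ∧
    (∃ A : ℝ, ∀ y ∈ Metric.ball (0 : Plane) ρ, |a y| ≤ A) ∧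
    ∀ y ∈ Metric.ball (0 : Plane) ρ, y ≠ 0 →
      metricMatrix g χ y =
        Real.exp (2 * (a y + (α / (2 * Real.pi) - 1) * Real.log ‖y‖)) •
          (1 : Matrix (Fin 2) (Fin 2) ℝ)

/-- A cone surface on the topological space `M`: a finite set of points, a smooth structure and
a smooth Riemannian metric on the complement, such that the given points are
cone points with cone angles in `(0, 2π]`. -/
structure ConeSurface (M : Type*) [TopologicalSpace M] where
  /-- the set of cone points -/
  sing : Finset M
  /-- the smooth atlas of the complement of the cone points -/
  charted : ChartedSpace Plane {x : M // x ∉ sing}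
  /-- the charts are smoothly compatible -/
  smooth : IsManifold (𝓡 2) ∞ {x : M // x ∉ sing}
  /-- the Riemannian metric -/
  metric : SmoothMetric {x : M // x ∉ sing}
  /-- the cone angles -/
  angle : M → ℝ
  angle_pos : ∀ p ∈ sing, 0 < angle p
  angle_le : ∀ p ∈ sing, angle p ≤ 2 * Real.pi
  cone : ∀ p ∈ sing, IsConePoint sing metric p (angle p)

namespace ConeSurface

variable {M : Type*} [TopologicalSpace M]

/-- The smooth part `M ∖ {p₁, …, pₙ}`. -/
abbrev Reg (C : ConeSurface M) : Type _ := {x : M // x ∉ C.sing}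

instance (C : ConeSurface M) : ChartedSpace Plane C.Reg := C.charted

instance (C : ConeSurface M) : IsManifold (𝓡 2) ∞ C.Reg := C.smooth

/-- The coordinate charts of the smooth part: all charts of its maximal smooth atlas. -/
def charts (C : ConeSurface M) : Set (OpenPartialHomeomorph C.Reg Plane) :=
  IsManifold.maximalAtlas (𝓡 2) ∞ C.Reg

/-- The Laplacian of `f : M → ℝ` at the smooth point `x`, computed in the chart `χ` around `x`. -/
def lap (C : ConeSurface M) (χ : OpenPartialHomeomorph C.Reg Plane) (f : M → ℝ) (x : C.Reg) : ℝ :=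
  coordLap (metricMatrix C.metric χ) (fun y => f (χ.symm y : C.Reg)) (χ x)

/-- `|∇f|` at the smooth point `x`, computed in the chart `χ` around `x`. -/
def gradNorm (C : ConeSurface M) (χ : OpenPartialHomeomorph C.Reg Plane) (f : M → ℝ)
    (x : C.Reg) : ℝ :=
  coordGradNorm (metricMatrix C.metric χ) (fun y => f (χ.symm y : C.Reg)) (χ x)

/-- `|∇²f|` at the smooth point `x`, computed in the chart `χ` around `x`. -/
def hessNorm (C : ConeSurface M) (χ : OpenPartialHomeomorph C.Reg Plane) (f : M → ℝ)
    (x : C.Reg) : ℝ :=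
  coordHessNorm (metricMatrix C.metric χ) (fun y => f (χ.symm y : C.Reg)) (χ x)

/-- `u ∈ C^{2,1}(M × (0,T])`: on the smooth part, `u` is `C²` in space and `C¹` in time on
`(0,T]`, and the `C²`-norm `sup |u| + sup |∇u| + sup |∇²u|` is finite; the suprema are over all
smooth points and all times in `(0,T]`, and the norms are those of the metric. -/
structure C21 (C : ConeSurface M) (T : ℝ) (u : M → ℝ → ℝ) : Prop where
  space : ∀ t ∈ Set.Ioc (0 : ℝ) T, ContMDiff (𝓡 2) 𝓘(ℝ, ℝ) 2 (fun x : C.Reg => u x t)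
  time : ∀ x : C.Reg, ContDiffOn ℝ 1 (u x) (Set.Ioc (0 : ℝ) T)
  bound : ∃ K : ℝ, ∀ t ∈ Set.Ioc (0 : ℝ) T, ∀ x : C.Reg, |u x t| ≤ K ∧
    ∀ χ ∈ C.charts, x ∈ χ.source →
      C.gradNorm χ (fun q => u q t) x ≤ K ∧ C.hessNorm χ (fun q => u q t) x ≤ K

/-- `∂u/∂t ≤ Δu` at every smooth point and every time in `(0,T]` (at `t = T` the time derivative
is the left derivative). The Laplacian does not depend on the chart, and any chart may be
used. -/
def HeatSubsolution (C : ConeSurface M) (T : ℝ) (u : M → ℝ → ℝ) : Prop :=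
  ∀ t ∈ Set.Ioc (0 : ℝ) T, ∀ x : C.Reg, ∀ χ ∈ C.charts, x ∈ χ.source →
    derivWithin (u x) (Set.Ioc (0 : ℝ) T) t ≤ C.lap χ (fun q => u q t) x

end ConeSurface

end ConeMax

end

/-!
A point of a surface is invisible to bounded subsolutions of the heat equation because `log r` is
harmonic in the plane and unbounded. In two dimensions a conformal factor only rescales the
Laplacian, so near a cone point of angle at most `2π` the function
`log (r² / r₀²) + 1 - r² / r₀²` still has Laplacian bounded below; it is nonpositive, vanishes at
`r = r₀`, and tends to `-∞` at the cone point. Its extensions by `0` sum to a function `φ`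
on the regular part which tends to `-∞` at every cone point and satisfies `Δφ ≥ -B` in the
barrier sense. For `ε > 0`, the function `u + ε φ - ε (B + 1) t` then has a maximum on the regular
part, and the derivative tests in space and time place it at `t = 0`. Letting `ε → 0` gives
`u ≤ max u(·, 0)` on the regular part, which is dense.
-/

noncomputable section

namespace ConeMax

open Filter Set Topology

section SecondDerivativeTest

theorem deriv_deriv_nonpos_of_isLocalMax {f : ℝ → ℝ} {x : ℝ} (hf : ContinuousAt f x)
    (h : IsLocalMax f x) : deriv (deriv f) x ≤ 0 := by
  by_contra! hpos
  have hmin : IsLocalMin f x := isLocalMin_of_deriv_deriv_pos hpos h.deriv_eq_zero hf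
  have hconst : f =ᶠ[𝓝 x] fun _ => f x := by
    filter_upwards [h, hmin] with z hle hge using le_antisymm hle hge
  have hzero : deriv (deriv f) x = 0 := by
    rw [hconst.deriv.deriv_eq, deriv_const', deriv_const]
  exact hpos.ne' hzero

variable {E : Type*} [NormedAddCommGroup E] [NormedSpace ℝ E]

theorem fderiv_fderiv_apply_self_nonpos_of_isLocalMax {f : E → ℝ} {x : E}
    (hf : ContDiffAt ℝ 2 f x) (h : IsLocalMax f x) (v : E) :
    fderiv ℝ (fderiv ℝ f) x v v ≤ 0 := by
  let line : ℝ → E := fun s => x + s • v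
  have hline : ∀ s, HasDerivAt line v s := fun s => by
    simpa only [id_eq, one_smul] using ((hasDerivAt_id s).smul_const v).const_add x
  have hline0 : line 0 = x := by simp [line]
  have htendsto : Tendsto line (𝓝 0) (𝓝 x) := hline0 ▸ (hline 0).continuousAt.tendsto
  have hmax : IsLocalMax (f ∘ line) 0 := by
    simpa only [IsLocalMax, IsMaxFilter, Function.comp_apply, hline0] using htendsto.eventually h
  have hfirst : deriv (f ∘ line) =ᶠ[𝓝 0] fun s => fderiv ℝ f (line s) v := by
    filter_upwards [htendsto.eventually (hf.eventually (by simp))] with s hs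
    exact ((hs.differentiableAt (by norm_num)).hasFDerivAt.comp_hasDerivAt s (hline s)).deriv
  have hsecond : HasDerivAt (fun s => fderiv ℝ f (line s) v) (fderiv ℝ (fderiv ℝ f) x v v) 0 := by
    have hdiff : HasFDerivAt (fderiv ℝ f) (fderiv ℝ (fderiv ℝ f) x) (line 0) := by
      rw [hline0]
      exact ((hf.fderiv_right (m := 1) (by norm_num)).differentiableAt (by norm_num)).hasFDerivAt
    exact (ContinuousLinearMap.apply ℝ ℝ v).hasFDerivAt.comp_hasDerivAt 0
      (hdiff.comp_hasDerivAt 0 (hline 0))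
  rw [← hsecond.deriv, ← hfirst.deriv_eq]
  exact deriv_deriv_nonpos_of_isLocalMax
    (ContinuousAt.comp (hline0 ▸ hf.continuousAt) (hline 0).continuousAt) hmax

end SecondDerivativeTest

theorem le_derivWithin_Ioc_of_isMaxOn {h : ℝ → ℝ} {a b t k : ℝ} (ht : t ∈ Ioc a b)
    (hd : DifferentiableWithinAt ℝ h (Ioc a b) t)
    (hmax : IsMaxOn (fun s => h s - k * s) (Ioc a b) t) :
    k ≤ derivWithin h (Ioc a b) t := by
  have hder : HasDerivWithinAt (fun s => h s - k * s) (derivWithin h (Ioc a b) t - k * 1)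
      (Ioc a b) t :=
    hd.hasDerivWithinAt.sub ((hasDerivAt_id t).const_mul k).hasDerivWithinAt
  have hleft : (a + t) / 2 - t ∈ posTangentConeAt (Ioc a b) t :=
    sub_mem_posTangentConeAt_of_segment_subset <| (convex_Ioc a b).segment_subset ht
      ⟨by linarith [ht.1], by linarith [ht.1, ht.2]⟩
  have hslope : ((a + t) / 2 - t) * (derivWithin h (Ioc a b) t - k) ≤ 0 := by
    simpa using hmax.localize.hasFDerivWithinAt_nonpos hder.hasFDerivWithinAt hleft
  nlinarith [ht.1]

section Coordinates

variable {G : Plane → Matrix (Fin 2) (Fin 2) ℝ} {f w : Plane → ℝ} {y : Plane}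

theorem pd_pd_eq_fderiv_fderiv (hf : ContDiffAt ℝ 2 f y) (i j : Fin 2) :
    pd i (fun z => pd j f z) y = fderiv ℝ (fderiv ℝ f) y (stdVec i) (stdVec j) := by
  have hdiff : DifferentiableAt ℝ (fderiv ℝ f) y :=
    (hf.fderiv_right (m := 1) (by norm_num)).differentiableAt (by norm_num)
  simp only [pd]
  rw [fderiv_clm_apply hdiff (differentiableAt_const _)]
  simp

theorem pd_add_const_mul (hf : DifferentiableAt ℝ f y) (hw : DifferentiableAt ℝ w y) (ε : ℝ)
    (i : Fin 2) : pd i (fun z => f z + ε * w z) y = pd i f y + ε * pd i w y := by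
  simp only [pd]
  rw [fderiv_fun_add hf (hw.const_mul ε), fderiv_const_mul hw]
  simp

theorem pd_pd_add_const_mul (hf : ContDiffAt ℝ 2 f y) (hw : ContDiffAt ℝ 2 w y) (ε : ℝ)
    (i j : Fin 2) : pd i (fun z => pd j (fun z => f z + ε * w z) z) y =
      pd i (fun z => pd j f z) y + ε * pd i (fun z => pd j w z) y := by
  have hdiff : ∀ {f : Plane → ℝ}, ContDiffAt ℝ 2 f y →
      DifferentiableAt ℝ (fun z => pd j f z) y := fun hf =>
    ((hf.fderiv_right (m := 1) (by norm_num)).differentiableAt (by norm_num)).clm_apply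
      (differentiableAt_const _)
  have hpd : (fun z => pd j (fun z => f z + ε * w z) z) =ᶠ[𝓝 y]
      fun z => pd j f z + ε * pd j w z := by
    filter_upwards [hf.eventually (by simp), hw.eventually (by simp)] with z hfz hwz
    exact pd_add_const_mul (hfz.differentiableAt (by norm_num))
      (hwz.differentiableAt (by norm_num)) ε j
  rw [pd, hpd.fderiv_eq, ← pd, pd_add_const_mul (hdiff hf) (hdiff hw)]

theorem coordLap_add_const_mul (hf : ContDiffAt ℝ 2 f y) (hw : ContDiffAt ℝ 2 w y) (ε : ℝ) :
    coordLap G (fun z => f z + ε * w z) y = coordLap G f y + ε * coordLap G w y := by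
  have hpd := pd_add_const_mul (hf.differentiableAt (by norm_num))
    (hw.differentiableAt (by norm_num)) ε
  simp only [coordLap, coordHess, pd_pd_add_const_mul hf hw, hpd, Fin.sum_univ_two]
  ring

theorem coordLap_zero : coordLap G (fun _ => 0) y = 0 := by
  simp [coordLap, coordHess, pd]

open scoped MatrixOrder Matrix.Norms.L2Operator in
theorem coordLap_nonpos_of_isLocalMax (hG : (G y).PosSemidef) (hf : ContDiffAt ℝ 2 f y)
    (h : IsLocalMax f y) : coordLap G f y ≤ 0 := by
  obtain ⟨B, hB⟩ : ∃ B, (G y)⁻¹ = star B * B :=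
    CStarAlgebra.nonneg_iff_eq_star_mul_self.mp hG.inv.nonneg
  have hcrit : ∀ k, pd k f y = 0 := fun k => by simp [pd, h.fderiv_eq_zero]
  have hrow : ∀ k, fderiv ℝ (fderiv ℝ f) y (∑ i, B k i • stdVec i) (∑ i, B k i • stdVec i) ≤ 0 :=
    fun k => fderiv_fderiv_apply_self_nonpos_of_isLocalMax hf h _
  have htrace : coordLap G f y =
      ∑ k, fderiv ℝ (fderiv ℝ f) y (∑ i, B k i • stdVec i) (∑ i, B k i • stdVec i) := by
    simp only [coordLap, coordHess, hcrit, hB, pd_pd_eq_fderiv_fderiv hf, Matrix.mul_apply,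
      Matrix.star_apply, Fin.sum_univ_two, star_trivial, map_add, map_smul, add_apply, smul_apply,
      smul_eq_mul]
    ring
  exact htrace ▸ Finset.sum_nonpos fun k _ => hrow k

theorem inv_smul_one {n K : Type*} [Fintype n] [DecidableEq n] [Field K] (e : K) :
    (e • (1 : Matrix n n K))⁻¹ = e⁻¹ • 1 := by
  rcases eq_or_ne e 0 with rfl | he
  · simp
  · exact Matrix.inv_eq_left_inv (by simp [smul_smul, he])

/- The Christoffel terms cancel in the trace: this is the conformal invariance of the Laplacian in
dimension two. -/
theorem coordLap_of_eventually_eq_smul_one {E : Plane → ℝ}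
    (hG : ∀ᶠ z in 𝓝 y, G z = E z • (1 : Matrix (Fin 2) (Fin 2) ℝ)) :
    coordLap G f y = (E y)⁻¹ * ∑ i, pd i (fun z => pd i f z) y := by
  have hpd : ∀ l i j, pd l (fun z => G z i j) y
      = pd l E y * (1 : Matrix (Fin 2) (Fin 2) ℝ) i j := by
    intro l i j
    have hentry : (fun z => G z i j) =ᶠ[𝓝 y] fun z => E z * (1 : Matrix (Fin 2) (Fin 2) ℝ) i j := by
      filter_upwards [hG] with z hz
      rw [hz, Matrix.smul_apply, smul_eq_mul]
    rw [pd, hentry.fderiv_eq]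
    obtain rfl | hij := eq_or_ne i j
    · simp [pd]
    · simp [Matrix.one_apply_ne hij]
  simp only [coordLap, coordHess, christoffel, hpd, hG.self_of_nhds, inv_smul_one,
    Fin.sum_univ_two, Matrix.smul_apply, smul_eq_mul, Matrix.one_apply_eq, ne_eq, zero_ne_one,
    one_ne_zero, not_false_eq_true, Matrix.one_apply_ne]
  ring

end Coordinates

section RadialLog

/-- The model barrier `log (|y|² / r²) + 1 - |y|² / r²` on the punctured plane. Since
`Real.log 0 = 0`, its value at the puncture is meaningless. -/
def radialLog (r : ℝ) (y : Plane) : ℝ := Real.log (‖y‖ ^ 2 / r ^ 2) + 1 - ‖y‖ ^ 2 / r ^ 2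

variable {r : ℝ} {y : Plane}

theorem radialLog_nonpos (hr : r ≠ 0) (hy : y ≠ 0) : radialLog r y ≤ 0 := by
  have hlog := Real.log_le_sub_one_of_pos (x := ‖y‖ ^ 2 / r ^ 2) (by positivity)
  rw [radialLog]
  linarith

theorem radialLog_eq_zero_of_norm_eq (hr : r ≠ 0) (hy : ‖y‖ = r) : radialLog r y = 0 := by
  simp [radialLog, hy, hr]

theorem contDiffAt_radialLog (hr : r ≠ 0) (hy : y ≠ 0) : ContDiffAt ℝ 2 (radialLog r) y := by
  have hsq : ContDiffAt ℝ 2 (fun z : Plane => ‖z‖ ^ 2 / r ^ 2) y :=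
    (contDiff_norm_sq ℝ).contDiffAt.div_const _
  exact ((hsq.log (by positivity)).add contDiffAt_const).sub hsq

theorem tendsto_radialLog_atBot (hr : r ≠ 0) : Tendsto (radialLog r) (𝓝[≠] 0) atBot := by
  have hsq : Tendsto (fun y : Plane => ‖y‖ ^ 2 / r ^ 2) (𝓝[≠] 0) (𝓝[>] 0) := by
    refine tendsto_nhdsWithin_iff.mpr ⟨?_, eventually_mem_nhdsWithin.mono fun y hy => ?_⟩
    · have hcont : Continuous fun y : Plane => ‖y‖ ^ 2 / r ^ 2 := by fun_prop
      simpa using (hcont.tendsto 0).mono_left nhdsWithin_le_nhds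
    · have : y ≠ 0 := hy
      exact mem_Ioi.mpr (by positivity)
  have hlog : Tendsto (fun y : Plane => Real.log (‖y‖ ^ 2 / r ^ 2)) (𝓝[≠] 0) atBot :=
    Real.tendsto_log_nhdsGT_zero.comp hsq
  refine tendsto_atBot_mono (fun y => ?_) (tendsto_atBot_add_const_right _ 1 hlog)
  exact sub_le_self _ (by positivity)

theorem pd_radialLog (hr : r ≠ 0) (hy : y ≠ 0) (i : Fin 2) :
    pd i (radialLog r) y = 2 * y i * ((‖y‖ ^ 2)⁻¹ - (r ^ 2)⁻¹) := by
  have hsq : HasFDerivAt (fun z : Plane => ‖z‖ ^ 2) (2 • innerSL ℝ y) y :=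
    (hasStrictFDerivAt_norm_sq y).hasFDerivAt
  have hdiv : HasFDerivAt (fun z : Plane => ‖z‖ ^ 2 / r ^ 2) ((r ^ 2)⁻¹ • 2 • innerSL ℝ y) y := by
    simpa only [div_eq_mul_inv] using hsq.mul_const (r ^ 2)⁻¹
  have hlog : HasFDerivAt (radialLog r) _ y := ((hdiv.log (by positivity)).add_const 1).sub hdiv
  rw [pd, hlog.fderiv]
  have hy' : ‖y‖ ≠ 0 := norm_ne_zero_iff.mpr hy
  simp only [stdVec, sub_apply, smul_apply, coe_innerSL_apply, EuclideanSpace.inner_single_right,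
    Real.ringHom_apply, nsmul_eq_mul, Nat.cast_ofNat, smul_eq_mul]
  field_simp

theorem pd_pd_radialLog (hr : r ≠ 0) (hy : y ≠ 0) (i : Fin 2) :
    pd i (fun z => pd i (radialLog r) z) y =
      2 * ((‖y‖ ^ 2)⁻¹ - (r ^ 2)⁻¹) - 4 * y i ^ 2 * ((‖y‖ ^ 2) ^ 2)⁻¹ := by
  have hpd : (fun z => pd i (radialLog r) z) =ᶠ[𝓝 y]
      fun z => 2 * z i * ((‖z‖ ^ 2)⁻¹ - (r ^ 2)⁻¹) := by
    filter_upwards [isOpen_ne.mem_nhds hy] with z hz using pd_radialLog hr hz i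
  have hcoord : HasFDerivAt (fun z : Plane => z i) (EuclideanSpace.proj i : Plane →L[ℝ] ℝ) y :=
    (EuclideanSpace.proj i : Plane →L[ℝ] ℝ).hasFDerivAt
  have hsq : HasFDerivAt (fun z : Plane => ‖z‖ ^ 2) (2 • innerSL ℝ y) y :=
    (hasStrictFDerivAt_norm_sq y).hasFDerivAt
  have hinv := (hasDerivAt_inv (show ‖y‖ ^ 2 ≠ 0 by positivity)).comp_hasFDerivAt y hsq
  have hprod : HasFDerivAt (fun z : Plane => 2 * z i * ((‖z‖ ^ 2)⁻¹ - (r ^ 2)⁻¹)) _ y :=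
    (hcoord.const_mul 2).mul (hinv.sub_const _)
  rw [pd, hpd.fderiv_eq, hprod.fderiv]
  simp only [stdVec, add_apply, smul_apply, coe_innerSL_apply, EuclideanSpace.inner_single_right,
    Real.ringHom_apply, nsmul_eq_mul, Nat.cast_ofNat, smul_eq_mul, PiLp.proj_apply,
    PiLp.single_eq_same]
  ring

theorem flatLap_radialLog (hr : r ≠ 0) (hy : y ≠ 0) :
    ∑ i, pd i (fun z => pd i (radialLog r) z) y = -(4 / r ^ 2) := by
  have hnorm : ‖y‖ ^ 2 = y 0 ^ 2 + y 1 ^ 2 := by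
    rw [EuclideanSpace.real_norm_sq_eq, Fin.sum_univ_two]
  have hpos : y 0 ^ 2 + y 1 ^ 2 ≠ 0 := hnorm ▸ by positivity
  simp only [Fin.sum_univ_two, pd_pd_radialLog hr hy, hnorm]
  field_simp
  ring

end RadialLog

theorem exists_isMaxOn_add_of_tendsto_cocompact {X Y : Type*} [TopologicalSpace X]
    [TopologicalSpace Y] [Nonempty X] {s : Set Y} (hs : IsCompact s) (hne : s.Nonempty)
    {F : X × Y → ℝ} (hF : ContinuousOn F (univ ×ˢ s)) {K : ℝ} (hK : ∀ z ∈ univ ×ˢ s, F z ≤ K)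
    {φ : X → ℝ} (hφ : Continuous φ) (hlim : Tendsto φ (cocompact X) atBot) :
    ∃ z ∈ univ ×ˢ s, IsMaxOn (fun z => F z + φ z.1) (univ ×ˢ s) z := by
  obtain ⟨x₀⟩ := ‹Nonempty X›
  obtain ⟨y₀, hy₀⟩ := hne
  obtain ⟨Q, hQ, hsub⟩ := mem_cocompact.mp (hlim.eventually_lt_atBot (F (x₀, y₀) + φ x₀ - K))
  have hout : ∀ x ∉ Q, φ x < F (x₀, y₀) + φ x₀ - K := fun x hx => hsub hx
  have hmem₀ : (x₀, y₀) ∈ Q ×ˢ s := ⟨by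
    by_contra hx₀
    linarith [hK (x₀, y₀) ⟨mem_univ _, hy₀⟩, hout x₀ hx₀], hy₀⟩
  obtain ⟨z, hz, hmax⟩ := (hQ.prod hs).exists_isMaxOn ⟨_, hmem₀⟩
    ((hF.mono (prod_mono_left (subset_univ Q))).add (hφ.comp continuous_fst).continuousOn)
  have hle : ∀ w ∈ Q ×ˢ s, F w + φ w.1 ≤ F z + φ z.1 := isMaxOn_iff.mp hmax
  refine ⟨z, ⟨mem_univ _, hz.2⟩, isMaxOn_iff.mpr fun w hw => ?_⟩
  by_cases hwQ : w.1 ∈ Q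
  · exact hle w ⟨hwQ, hw.2⟩
  · linarith [hK w hw, hout w.1 hwQ, hle _ hmem₀]

section RiemannianSurface

variable {X : Type*} [TopologicalSpace X] [ChartedSpace Plane X]

theorem contDiffAt_comp_symm {χ : OpenPartialHomeomorph X Plane}
    (hχ : χ ∈ IsManifold.maximalAtlas (𝓡 2) ∞ X) {f : X → ℝ}
    (hf : ContMDiff (𝓡 2) 𝓘(ℝ, ℝ) 2 f) {y : Plane} (hy : y ∈ χ.target) :
    ContDiffAt ℝ 2 (fun z => f (χ.symm z)) y := by
  have hsymm : ContMDiffAt (𝓡 2) (𝓡 2) 2 χ.symm y :=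
    (contMDiffAt_symm_of_mem_maximalAtlas hχ hy).of_le
      (WithTop.coe_le_coe.mpr (le_top : (2 : ℕ∞) ≤ ⊤))
  exact (hf.contMDiffAt.comp y hsymm).contDiffAt

variable [IsManifold (𝓡 2) ∞ X] {g : SmoothMetric X}

theorem metricMatrix_posSemidef (g : SmoothMetric X) (χ : OpenPartialHomeomorph X Plane)
    (y : Plane) : (metricMatrix g χ y).PosSemidef := by
  have hinner : ∀ v : TangentSpace (𝓡 2) (χ.symm y), 0 ≤ g.inner (χ.symm y) v v := fun v => by
    rcases eq_or_ne v 0 with rfl | hv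
    · simp
    · exact (g.pos _ v hv).le
  have hgram : ∀ (b : Fin 2 → ℝ) (D : Plane →L[ℝ] TangentSpace (𝓡 2) (χ.symm y)),
      0 ≤ star b ⬝ᵥ (Matrix.of fun i j : Fin 2 =>
        g.inner (χ.symm y) (D (stdVec i)) (D (stdVec j))).mulVec b := by
    intro b D
    have h := hinner (b 0 • D (stdVec 0) + b 1 • D (stdVec 1))
    simp only [map_add, map_smul, add_apply, smul_apply, smul_eq_mul] at h
    simp only [dotProduct, Matrix.mulVec, Fin.sum_univ_two, Matrix.of_apply, Pi.star_apply,
      star_trivial]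
    linarith
  refine Matrix.PosSemidef.of_dotProduct_mulVec_nonneg ?_ fun b => hgram b _
  ext i j
  exact g.symm _ _ _

/-- `Δφ ≥ c` at `x` in the barrier sense of Calabi: in some chart, `φ` is touched from below at `x`
by a `C²` function `w` with `Δw ≥ c` at `x`. -/
def LapGE (g : SmoothMetric X) (φ : X → ℝ) (c : ℝ) (x : X) : Prop :=
  ∃ χ ∈ IsManifold.maximalAtlas (𝓡 2) ∞ X, x ∈ χ.source ∧ ∃ w : Plane → ℝ,
    ContDiffAt ℝ 2 w (χ x) ∧ w (χ x) = φ x ∧ (∀ᶠ y in 𝓝 (χ x), w y ≤ φ (χ.symm y)) ∧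
    c ≤ coordLap (metricMatrix g χ) w (χ x)

namespace LapGE

variable {φ ψ : X → ℝ} {c d : ℝ} {x : X}

theorem mono (h : LapGE g φ c x) (hdc : d ≤ c) : LapGE g φ d x :=
  let ⟨χ, hχ, hx, w, hw, heq, hle, hlap⟩ := h
  ⟨χ, hχ, hx, w, hw, heq, hle, hdc.trans hlap⟩

theorem congr (h : LapGE g φ c x) (hφψ : φ =ᶠ[𝓝 x] ψ) : LapGE g ψ c x := by
  obtain ⟨χ, hχ, hx, w, hw, heq, hle, hlap⟩ := h
  refine ⟨χ, hχ, hx, w, hw, heq.trans hφψ.eq_of_nhds, ?_, hlap⟩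
  filter_upwards [hle, (χ.tendsto_symm hx).eventually hφψ] with y hy hφψy using hφψy ▸ hy

theorem zero (g : SmoothMetric X) (hc : c ≤ 0) (x : X) : LapGE g 0 c x :=
  ⟨chartAt Plane x, IsManifold.chart_mem_maximalAtlas x, mem_chart_source _ x, fun _ => 0,
    contDiffAt_const, rfl, Eventually.of_forall fun _ => le_rfl, coordLap_zero.symm ▸ hc⟩

theorem exists_coordLap_le_of_isLocalMax (hφ : LapGE g φ c x) {f : X → ℝ}
    (hf : ContMDiff (𝓡 2) 𝓘(ℝ, ℝ) 2 f) {ε : ℝ} (hε : 0 ≤ ε)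
    (hmax : IsLocalMax (fun z => f z + ε * φ z) x) :
    ∃ χ ∈ IsManifold.maximalAtlas (𝓡 2) ∞ X, x ∈ χ.source ∧
      coordLap (metricMatrix g χ) (fun y => f (χ.symm y)) (χ x) ≤ -(ε * c) := by
  obtain ⟨χ, hχ, hx, w, hw, hwx, hle, hlap⟩ := hφ
  have hf' : ContDiffAt ℝ 2 (fun y => f (χ.symm y)) (χ x) :=
    contDiffAt_comp_symm hχ hf (χ.map_source hx)
  have hmax' : IsLocalMax (fun y => f (χ.symm y) + ε * w y) (χ x) := by
    filter_upwards [hle, (χ.tendsto_symm hx).eventually hmax] with y hwy hy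
    rw [χ.left_inv hx, hwx]
    exact (add_le_add_right (mul_le_mul_of_nonneg_left hwy hε) _).trans hy
  have hsum := coordLap_nonpos_of_isLocalMax (metricMatrix_posSemidef g χ (χ x))
    (hf'.add (contDiffAt_const.mul hw)) hmax'
  rw [coordLap_add_const_mul hf' hw] at hsum
  exact ⟨χ, hχ, hx, by linarith [mul_le_mul_of_nonneg_left hlap hε]⟩

end LapGE

/-- A continuous nonpositive function with `Δφ ≥ -B` in the barrier sense which tends to `-∞` along
the filter `l`. For `l = cocompact X` this is the Khas'minskii condition for stochastic
completeness; for the neighbourhoods of a puncture it is a local version of it. -/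
structure IsBarrier (g : SmoothMetric X) (l : Filter X) (B : ℝ) (φ : X → ℝ) : Prop where
  continuous : Continuous φ
  nonpos : ∀ x, φ x ≤ 0
  tendsto : Tendsto φ l atBot
  lapGE : ∀ x, LapGE g φ (-B) x

namespace IsBarrier

theorem mono {l l' : Filter X} {B B' : ℝ} {φ : X → ℝ} (h : IsBarrier g l B φ) (hl : l' ≤ l)
    (hB : B ≤ B') : IsBarrier g l' B' φ where
  continuous := h.continuous
  nonpos := h.nonpos
  tendsto := h.tendsto.mono_left hl
  lapGE x := (h.lapGE x).mono (neg_le_neg hB)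

theorem sum {ι : Type*} {s : Finset ι} {l : ι → Filter X} {B : ℝ} {φ : ι → X → ℝ} (hB : 0 ≤ B)
    (hφ : ∀ i ∈ s, IsBarrier g (l i) B (φ i))
    (hdisj : (s : Set ι).PairwiseDisjoint fun i => tsupport (φ i)) :
    IsBarrier g (⨆ i ∈ s, l i) B (∑ i ∈ s, φ i) where
  continuous := by
    simpa only [Finset.sum_fn] using continuous_finsetSum s fun i hi => (hφ i hi).continuous
  nonpos x := by
    simpa only [Finset.sum_apply] using Finset.sum_nonpos fun i hi => (hφ i hi).nonpos x
  tendsto := by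
    refine tendsto_iSup.mpr fun i => tendsto_iSup.mpr fun hi =>
      tendsto_atBot_mono (fun x => ?_) (hφ i hi).tendsto
    classical
    rw [Finset.sum_apply, ← Finset.add_sum_erase s _ hi]
    exact add_le_of_nonpos_right
      (Finset.sum_nonpos fun j hj => (hφ j (Finset.mem_of_mem_erase hj)).nonpos x)
  lapGE x := by
    have hvanish : ∀ t : Finset ι, (∀ i ∈ t, x ∉ tsupport (φ i)) → ∑ i ∈ t, φ i =ᶠ[𝓝 x] 0 := by
      intro t ht
      filter_upwards [(Finset.eventually_all t).2 fun i hi =>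
        notMem_tsupport_iff_eventuallyEq.mp (ht i hi)] with z hz
      rw [Finset.sum_apply]
      exact Finset.sum_eq_zero hz
    classical
    by_cases hx : ∃ i ∈ s, x ∈ tsupport (φ i)
    · obtain ⟨i, hi, hxi⟩ := hx
      have hrest : ∑ j ∈ s.erase i, φ j =ᶠ[𝓝 x] 0 := hvanish _ fun j hj hxj =>
        (hdisj (Finset.mem_of_mem_erase hj) hi (Finset.ne_of_mem_erase hj)).ne_of_mem hxj hxi rfl
      refine ((hφ i hi).lapGE x).congr ?_
      rw [← Finset.add_sum_erase s φ hi]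
      simpa only [add_zero] using ((EventuallyEq.refl _ (φ i)).add hrest).symm
    · push Not at hx
      exact (LapGE.zero g (neg_nonpos.2 hB) x).congr (hvanish s hx).symm

end IsBarrier

/-- The closed disc of radius `r` about the origin of the coordinates `χ`. -/
def closedDisc (χ : OpenPartialHomeomorph X Plane) (r : ℝ) : Set X :=
  χ.source ∩ χ ⁻¹' Metric.closedBall 0 r

/-- The model barrier in the coordinates `χ`, extended by `0` outside the disc of radius `r`. -/
def logBarrier (χ : OpenPartialHomeomorph X Plane) (r : ℝ) : X → ℝ :=
  (closedDisc χ r).indicator fun x => radialLog r (χ x)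

/-- The chart `χ` is a conformal coordinate around a puncture of `X`, whose neighbourhoods are the
filter `l`: the coordinates tend to `0` along `l` without reaching it, the disc of radius `r` is
closed in `X`, and the inverse of the conformal factor is bounded by `A`. -/
structure IsPuncturedDisc (g : SmoothMetric X) (l : Filter X) (χ : OpenPartialHomeomorph X Plane)
    (r A : ℝ) : Prop where
  mem_maximalAtlas : χ ∈ IsManifold.maximalAtlas (𝓡 2) ∞ X
  radius_pos : 0 < r
  bound_nonneg : 0 ≤ A
  ne_zero : ∀ x ∈ χ.source, χ x ≠ 0
  isClosed : IsClosed (closedDisc χ r)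
  eventually_mem : ∀ᶠ x in l, x ∈ closedDisc χ r
  tendsto : Tendsto χ l (𝓝 0)
  conformal : ∃ E : Plane → ℝ, ∀ y ∈ χ.target, metricMatrix g χ y = E y • 1 ∧ (E y)⁻¹ ≤ A

namespace IsPuncturedDisc

variable {l : Filter X} {χ : OpenPartialHomeomorph X Plane} {r A : ℝ}

theorem tsupport_logBarrier_subset (h : IsPuncturedDisc g l χ r A) :
    tsupport (logBarrier χ r) ⊆ closedDisc χ r :=
  closure_minimal support_indicator_subset h.isClosed

theorem continuous_logBarrier (h : IsPuncturedDisc g l χ r A) : Continuous (logBarrier χ r) := by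
  refine continuous_indicator (fun x hx => ?_) ?_
  · obtain ⟨⟨hxχ, hxr⟩, hint⟩ := h.isClosed.frontier_eq ▸ hx
    refine radialLog_eq_zero_of_norm_eq h.radius_pos.ne' (le_antisymm (by simpa using hxr) ?_)
    by_contra! hlt
    exact hint <| mem_interior.mpr ⟨χ.source ∩ χ ⁻¹' Metric.ball 0 r,
      inter_subset_inter_right _ (preimage_mono Metric.ball_subset_closedBall),
      χ.isOpen_inter_preimage Metric.isOpen_ball, hxχ, by simpa using hlt⟩
  · rw [h.isClosed.closure_eq]
    exact fun x hx => ((contDiffAt_radialLog h.radius_pos.ne'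
      (h.ne_zero x hx.1)).continuousAt.comp (χ.continuousAt hx.1)).continuousWithinAt

theorem radialLog_le_logBarrier (h : IsPuncturedDisc g l χ r A) {y : Plane} (hy : y ∈ χ.target) :
    radialLog r y ≤ logBarrier χ r (χ.symm y) := by
  by_cases hmem : χ.symm y ∈ closedDisc χ r
  · rw [logBarrier, indicator_of_mem hmem, χ.right_inv hy]
  · rw [logBarrier, indicator_of_notMem hmem]
    refine radialLog_nonpos h.radius_pos.ne' ?_
    simpa only [χ.right_inv hy] using h.ne_zero _ (χ.map_target hy)

theorem le_coordLap_radialLog (h : IsPuncturedDisc g l χ r A) {x : X} (hx : x ∈ χ.source) :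
    -(4 * A / r ^ 2) ≤ coordLap (metricMatrix g χ) (radialLog r) (χ x) := by
  obtain ⟨E, hE⟩ := h.conformal
  have hy := χ.map_source hx
  rw [coordLap_of_eventually_eq_smul_one
      (eventually_of_mem (χ.open_target.mem_nhds hy) fun z hz => (hE z hz).1),
    flatLap_radialLog h.radius_pos.ne' (h.ne_zero x hx)]
  calc -(4 * A / r ^ 2) = -(A * (4 / r ^ 2)) := by ring
    _ ≤ -((E (χ x))⁻¹ * (4 / r ^ 2)) :=
        neg_le_neg (mul_le_mul_of_nonneg_right (hE _ hy).2 (by positivity))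
    _ = (E (χ x))⁻¹ * -(4 / r ^ 2) := by ring

theorem lapGE_logBarrier (h : IsPuncturedDisc g l χ r A) (x : X) :
    LapGE g (logBarrier χ r) (-(4 * A / r ^ 2)) x := by
  by_cases hx : x ∈ closedDisc χ r
  · exact ⟨χ, h.mem_maximalAtlas, hx.1, radialLog r,
      contDiffAt_radialLog h.radius_pos.ne' (h.ne_zero x hx.1),
      (indicator_of_mem hx fun z => radialLog r (χ z)).symm,
      eventually_of_mem (χ.open_target.mem_nhds (χ.map_source hx.1))
        fun y hy => h.radialLog_le_logBarrier hy,
      h.le_coordLap_radialLog hx.1⟩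
  · have hnonneg : 0 ≤ 4 * A / r ^ 2 := by have := h.bound_nonneg; positivity
    exact (LapGE.zero g (neg_nonpos.2 hnonneg) x).congr
      (notMem_tsupport_iff_eventuallyEq.mp fun hx' => hx (h.tsupport_logBarrier_subset hx')).symm

theorem isBarrier (h : IsPuncturedDisc g l χ r A) :
    IsBarrier g l (4 * A / r ^ 2) (logBarrier χ r) where
  continuous := h.continuous_logBarrier
  nonpos _ := indicator_apply_nonpos fun hx => radialLog_nonpos h.radius_pos.ne' (h.ne_zero _ hx.1)
  tendsto := by
    have hne : ∀ᶠ x in l, χ x ∈ ({0}ᶜ : Set Plane) :=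
      h.eventually_mem.mono fun x hx => h.ne_zero x hx.1
    refine ((tendsto_radialLog_atBot h.radius_pos.ne').comp
      (tendsto_nhdsWithin_iff.mpr ⟨h.tendsto, hne⟩)).congr' ?_
    filter_upwards [h.eventually_mem] with x hx
    exact (indicator_of_mem hx fun z => radialLog r (χ z)).symm
  lapGE := h.lapGE_logBarrier

end IsPuncturedDisc

/-- The function `u` is `C²` in space, differentiable in time and satisfies `∂u/∂t ≤ Δu` on
`X × (0, T]`, with the left derivative at `t = T` and the Laplacian computed in any chart. -/
structure IsHeatSubsolution (g : SmoothMetric X) (T : ℝ) (u : X → ℝ → ℝ) : Prop where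
  space : ∀ t ∈ Ioc 0 T, ContMDiff (𝓡 2) 𝓘(ℝ, ℝ) 2 fun x => u x t
  time : ∀ x, DifferentiableOn ℝ (u x) (Ioc 0 T)
  heat : ∀ t ∈ Ioc 0 T, ∀ x, ∀ χ ∈ IsManifold.maximalAtlas (𝓡 2) ∞ X, x ∈ χ.source →
    derivWithin (u x) (Ioc 0 T) t ≤ coordLap (metricMatrix g χ) (fun y => u (χ.symm y) t) (χ x)

namespace IsHeatSubsolution

variable {T : ℝ} {u : X → ℝ → ℝ} {φ : X → ℝ} {B : ℝ}

theorem eq_zero_of_isMaxOn (hu : IsHeatSubsolution g T u) (hφ : ∀ x, LapGE g φ (-B) x) {ε k : ℝ}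
    (hε : 0 ≤ ε) (hk : ε * B < k) {z : X × ℝ} (hz : z ∈ univ ×ˢ Icc 0 T)
    (hmax : IsMaxOn (fun z => u z.1 z.2 - k * z.2 + ε * φ z.1) (univ ×ˢ Icc 0 T) z) :
    z.2 = 0 := by
  obtain ⟨x, t⟩ := z
  by_contra hne
  have ht : t ∈ Ioc 0 T := ⟨lt_of_le_of_ne hz.2.1 (Ne.symm hne), hz.2.2⟩
  have hspace : IsLocalMax (fun y => u y t + ε * φ y) x := Eventually.of_forall fun y => by
    linarith [isMaxOn_iff.mp hmax (y, t) ⟨mem_univ y, hz.2⟩]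
  have htime : IsMaxOn (fun s => u x s - k * s) (Ioc 0 T) t := isMaxOn_iff.mpr fun s hs => by
    linarith [isMaxOn_iff.mp hmax (x, s) ⟨mem_univ x, Ioc_subset_Icc_self hs⟩]
  obtain ⟨χ, hχ, hx, hlap⟩ := (hφ x).exists_coordLap_le_of_isLocalMax (hu.space t ht) hε hspace
  have hderiv := le_derivWithin_Ioc_of_isMaxOn ht (hu.time x t ht) htime
  linarith [hu.heat t ht x χ hχ hx]

theorem le_add_mul_of_isBarrier (hu : IsHeatSubsolution g T u)
    (hφ : IsBarrier g (cocompact X) B φ)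
    (hcont : ContinuousOn (fun z : X × ℝ => u z.1 z.2) (univ ×ˢ Icc 0 T)) {K : ℝ}
    (hK : ∀ x, ∀ t ∈ Icc 0 T, u x t ≤ K) {c : ℝ} (hc : ∀ x, u x 0 ≤ c) {ε : ℝ} (hε : 0 < ε)
    {x : X} {t : ℝ} (ht : t ∈ Icc 0 T) : u x t ≤ c + ε * ((|B| + 1) * t - φ x) := by
  have hlinear : ∀ s ∈ Icc 0 T, 0 ≤ ε * (|B| + 1) * s := fun s hs => by
    have := hs.1
    positivity
  have : Nonempty X := ⟨x⟩
  obtain ⟨z, hz, hmax⟩ := exists_isMaxOn_add_of_tendsto_cocompact isCompact_Icc ⟨t, ht⟩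
    (F := fun z : X × ℝ => u z.1 z.2 - ε * (|B| + 1) * z.2) (hcont.sub (by fun_prop))
    (fun z hz => (sub_le_self _ (hlinear _ hz.2)).trans (hK _ _ hz.2))
    (hφ.continuous.const_mul ε) (hφ.tendsto.const_mul_atBot hε)
  have hz0 : z.2 = 0 := hu.eq_zero_of_isMaxOn hφ.lapGE hε.le
    (mul_lt_mul_of_pos_left ((le_abs_self B).trans_lt (lt_add_one _)) hε) hz hmax
  have hle := isMaxOn_iff.mp hmax (x, t) ⟨mem_univ x, ht⟩
  simp only [hz0, mul_zero, sub_zero] at hle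
  linarith [hc z.1, mul_nonpos_of_nonneg_of_nonpos hε.le (hφ.nonpos z.1)]

theorem le_of_isBarrier (hu : IsHeatSubsolution g T u) (hφ : IsBarrier g (cocompact X) B φ)
    (hcont : ContinuousOn (fun z : X × ℝ => u z.1 z.2) (univ ×ˢ Icc 0 T)) {K : ℝ}
    (hK : ∀ x, ∀ t ∈ Icc 0 T, u x t ≤ K) {c : ℝ} (hc : ∀ x, u x 0 ≤ c) (x : X) {t : ℝ}
    (ht : t ∈ Icc 0 T) : u x t ≤ c := by
  have hlim : Tendsto (fun ε => c + ε * ((|B| + 1) * t - φ x)) (𝓝[>] 0) (𝓝 c) := by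
    have haffine : Continuous fun ε => c + ε * ((|B| + 1) * t - φ x) := by fun_prop
    simpa using (haffine.tendsto 0).mono_left nhdsWithin_le_nhds
  exact ge_of_tendsto hlim <| eventually_mem_nhdsWithin.mono fun ε hε =>
    hu.le_add_mul_of_isBarrier hφ hcont hK hc hε ht

end IsHeatSubsolution

end RiemannianSurface

section ConePoint

variable {M : Type*} [TopologicalSpace M]

theorem closedDisc_eq_preimage_image {P : M → Prop} {κ : OpenPartialHomeomorph M Plane}
    {χ : OpenPartialHomeomorph {x // P x} Plane} (hsource : χ.source = Subtype.val ⁻¹' κ.source)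
    (hχκ : ∀ x ∈ χ.source, χ x = κ x) {r : ℝ} (hr : Metric.closedBall 0 r ⊆ κ.target) :
    closedDisc χ r = Subtype.val ⁻¹' (κ.symm '' Metric.closedBall 0 r) := by
  rw [κ.symm_image_eq_source_inter_preimage hr]
  ext x
  simp only [closedDisc, hsource, mem_inter_iff, mem_preimage]
  exact and_congr_right fun hx => by rw [hχκ x (hsource.superset hx)]

theorem inv_exp_two_mul_add_mul_log_le {a A β t ρ : ℝ} (ha : |a| ≤ A) (hβ : β ≤ 0) (ht : 0 < t)
    (htρ : t ≤ ρ) :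
    (Real.exp (2 * (a + β * Real.log t)))⁻¹ ≤ Real.exp (2 * (A - β * Real.log ρ)) := by
  rw [← Real.exp_neg, Real.exp_le_exp]
  linarith [neg_le_of_abs_le ha, mul_le_mul_of_nonpos_left (Real.log_le_log ht htρ) hβ]

theorem cocompact_le_iSup_comap_nhds [CompactSpace M] (S : Set M) :
    cocompact {x // x ∉ S} ≤ ⨆ p ∈ S, comap Subtype.val (𝓝 p) := by
  have hnhdsSet : cocompact {x // x ∉ S} ≤ comap Subtype.val (𝓝ˢ S) := by
    refine ((hasBasis_nhdsSet S).comap _).ge_iff.mpr fun U ⟨hU, hSU⟩ => ?_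
    have hcompact : IsCompact (Subtype.val ⁻¹' Uᶜ : Set {x // x ∉ S}) :=
      (IsEmbedding.subtypeVal.isInducing.isCompact_preimage_iff fun x (hx : x ∉ U) =>
        ⟨⟨x, fun hxS => hx (hSU hxS)⟩, rfl⟩).mpr hU.isClosed_compl.isCompact
    simpa only [preimage_compl, compl_compl] using hcompact.compl_mem_cocompact
  simpa only [nhdsSet, sSup_image, comap_iSup] using hnhdsSet

namespace IsConePoint

variable {S : Finset M} [ChartedSpace Plane {x : M // x ∉ S}]
  [IsManifold (𝓡 2) ∞ {x : M // x ∉ S}] {g : SmoothMetric {x : M // x ∉ S}} {p : M} {α : ℝ}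

theorem mem_closure_compl (h : IsConePoint S g p α) : p ∈ closure (S : Set M)ᶜ := by
  obtain ⟨ρ, κ, -, -, hρ, hp, hκp, htarget, hS, -⟩ := h
  have hsymm : Tendsto κ.symm (𝓝[≠] 0) (𝓝 p) :=
    (hκp ▸ κ.tendsto_symm hp).mono_left nhdsWithin_le_nhds
  have h0 : κ.target ∈ 𝓝[≠] 0 := mem_nhdsWithin_of_mem_nhds (htarget ▸ Metric.ball_mem_nhds 0 hρ)
  refine mem_closure_of_tendsto hsymm ?_
  filter_upwards [h0, self_mem_nhdsWithin] with y hy hy0 hyS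
  exact hy0 <| by rw [mem_singleton_iff, ← κ.right_inv hy, hS _ (κ.map_target hy) hyS, hκp]

theorem exists_isPuncturedDisc [T2Space M] (h : IsConePoint S g p α) (hp : p ∈ S)
    (hα : α ≤ 2 * Real.pi) {U : Set M} (hU : U ∈ 𝓝 p) :
    ∃ χ r A, IsPuncturedDisc g (comap Subtype.val (𝓝 p)) χ r A ∧
      closedDisc χ r ⊆ Subtype.val ⁻¹' U := by
  obtain ⟨ρ, κ, χ, a, hρ, hpκ, hκp, htarget, -, hχ, hsource, hχκ, -, ⟨A, hA⟩, hg⟩ := h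
  have hsymm : Tendsto κ.symm (𝓝 0) (𝓝 p) := hκp ▸ κ.tendsto_symm hpκ
  obtain ⟨r, hr, hball⟩ := Metric.nhds_basis_closedBall.mem_iff.mp
    (inter_mem (hsymm hU) (htarget ▸ Metric.ball_mem_nhds (0 : Plane) hρ : κ.target ∈ 𝓝 0))
  have hdisc := closedDisc_eq_preimage_image hsource hχκ fun y hy => (hball hy).2
  have hmem : ∀ x ∈ χ.source, (x : M) ∈ κ.source := fun x hx => hsource.subset hx
  have hne : ∀ x ∈ χ.source, χ x ≠ 0 := fun x hx hx0 =>
    x.2 <| κ.injOn (hmem x hx) hpκ (by rw [← hχκ x hx, hx0, hκp]) ▸ hp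
  have hnear : ∀ᶠ x : {x // x ∉ S} in comap Subtype.val (𝓝 p), x ∈ χ.source :=
    hsource ▸ preimage_mem_comap (κ.open_source.mem_nhds hpκ)
  have htendsto : Tendsto χ (comap Subtype.val (𝓝 p)) (𝓝 0) :=
    (hκp ▸ (κ.continuousAt hpκ).tendsto.comp tendsto_comap).congr' <|
      hnear.mono fun x hx => (hχκ x hx).symm
  refine ⟨χ, r, Real.exp (2 * (A - (α / (2 * Real.pi) - 1) * Real.log ρ)), ⟨hχ, hr,
    (Real.exp_pos _).le, hne, ?_, hnear.and (htendsto (Metric.closedBall_mem_nhds 0 hr)), htendsto,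
    fun y => Real.exp (2 * (a y + (α / (2 * Real.pi) - 1) * Real.log ‖y‖)), fun y hy => ?_⟩, ?_⟩
  · exact hdisc ▸ ((isCompact_closedBall 0 r).image_of_continuousOn (κ.continuousOn_symm.mono
      fun y hy => (hball hy).2)).isClosed.preimage continuous_subtype_val
  · have hyρ : y ∈ Metric.ball 0 ρ := by
      rw [← htarget, ← χ.right_inv hy, hχκ _ (χ.map_target hy)]
      exact κ.map_source (hmem _ (χ.map_target hy))
    have hy0 : y ≠ 0 := χ.right_inv hy ▸ hne _ (χ.map_target hy)
    exact ⟨hg y hyρ hy0, inv_exp_two_mul_add_mul_log_le (hA y hyρ) (sub_nonpos.mpr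
      ((div_le_one Real.two_pi_pos).mpr hα)) (norm_pos_iff.mpr hy0) (mem_ball_zero_iff.mp hyρ).le⟩
  · rw [hdisc]
    rintro x ⟨y, hy, hyx⟩
    simpa only [mem_preimage, hyx] using (hball hy).1

end IsConePoint

namespace ConeSurface

theorem denseRange_val (C : ConeSurface M) : DenseRange (Subtype.val : C.Reg → M) := by
  intro x
  have hrange : range (Subtype.val : C.Reg → M) = (C.sing : Set M)ᶜ := Subtype.range_val
  rw [hrange]
  by_cases hx : x ∈ C.sing
  · exact (C.cone x hx).mem_closure_compl
  · exact subset_closure hx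

theorem exists_isBarrier_cocompact [T2Space M] [CompactSpace M] (C : ConeSurface M) :
    ∃ B φ, IsBarrier C.metric (cocompact C.Reg) B φ := by
  obtain ⟨U, hU, hdisj⟩ := C.sing.finite_toSet.t2_separation
  have hlocal : ∀ p ∈ C.sing, ∃ B φ, IsBarrier C.metric (comap Subtype.val (𝓝 p)) B φ ∧
      tsupport φ ⊆ Subtype.val ⁻¹' U p := by
    intro p hp
    obtain ⟨χ, r, A, hdisc, hsub⟩ := (C.cone p hp).exists_isPuncturedDisc hp (C.angle_le p hp)
      ((hU p).2.mem_nhds (hU p).1)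
    exact ⟨_, _, hdisc.isBarrier, hdisc.tsupport_logBarrier_subset.trans hsub⟩
  choose! B φ hφ hsupp using hlocal
  have hB : ∀ p ∈ C.sing, B p ≤ ∑ q ∈ C.sing, |B q| := fun p hp =>
    (le_abs_self _).trans (Finset.single_le_sum (fun q _ => abs_nonneg (B q)) hp)
  have hdisjφ : (C.sing : Set M).PairwiseDisjoint fun p => tsupport (φ p) := fun p hp q hq hpq =>
    ((hdisj hp hq hpq).preimage _).mono (hsupp p hp) (hsupp q hq)
  exact ⟨_, _, (IsBarrier.sum (Finset.sum_nonneg fun q _ => abs_nonneg (B q))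
    (fun p hp => (hφ p hp).mono le_rfl (hB p hp)) hdisjφ).mono
      (cocompact_le_iSup_comap_nhds (C.sing : Set M)) le_rfl⟩

end ConeSurface

end ConePoint

end ConeMax

end

theorem theoremT_general {M : Type*} [TopologicalSpace M] [T2Space M] [CompactSpace M] [Nonempty M]
    (C : ConeMax.ConeSurface M) (T : ℝ) (hT : 0 ≤ T) (u : M → ℝ → ℝ)
    (hcont : ContinuousOn (fun z : M × ℝ => u z.1 z.2) (Set.univ ×ˢ Set.Icc (0 : ℝ) T))
    (hu : ConeMax.IsHeatSubsolution C.metric T fun x : C.Reg => u x) :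
    ∃ y : M, IsMaxOn (fun z : M × ℝ => u z.1 z.2) (Set.univ ×ˢ Set.Icc (0 : ℝ) T) (y, 0) := by
  have hslice : ∀ t ∈ Set.Icc 0 T, Continuous fun x => u x t := fun t ht =>
    hcont.comp_continuous (f := fun x => (x, t)) (by fun_prop) fun x => ⟨Set.mem_univ x, ht⟩
  have hreg : ContinuousOn (fun z : C.Reg × ℝ => u z.1 z.2) (Set.univ ×ˢ Set.Icc 0 T) :=
    hcont.comp (f := fun z : C.Reg × ℝ => ((z.1 : M), z.2)) (by fun_prop)
      fun z hz => ⟨Set.mem_univ _, hz.2⟩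
  obtain ⟨y, -, hy⟩ := isCompact_univ.exists_isMaxOn Set.univ_nonempty
    (hslice 0 ⟨le_rfl, hT⟩).continuousOn
  obtain ⟨K, hK⟩ := (isCompact_univ.prod isCompact_Icc).bddAbove_image hcont
  obtain ⟨B, φ, hφ⟩ := C.exists_isBarrier_cocompact
  refine ⟨y, isMaxOn_iff.mpr fun z hz => C.denseRange_val.induction_on z.1
    (isClosed_le (hslice z.2 hz.2) continuous_const) fun x => ?_⟩
  exact hu.le_of_isBarrier hφ hreg
    (fun x t ht => hK ⟨(x, t), ⟨Set.mem_univ _, ht⟩, rfl⟩) (fun x => hy (Set.mem_univ x.1)) x hz.2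

theorem theoremT {M : Type*} [TopologicalSpace M] [T2Space M] [CompactSpace M] [Nonempty M]
    (C : ConeMax.ConeSurface M) (T : ℝ) (hT : 0 < T) (u : M → ℝ → ℝ)
    (hcont : ContinuousOn (fun z : M × ℝ => u z.1 z.2) (Set.univ ×ˢ Set.Icc (0 : ℝ) T))
    (hu : C.C21 T u) (hheat : C.HeatSubsolution T u) :
    ∃ y : M, IsMaxOn (fun z : M × ℝ => u z.1 z.2) (Set.univ ×ˢ Set.Icc (0 : ℝ) T) (y, 0) :=
  theoremT_general C T hT.le u hcont
    ⟨hu.space, fun x => (hu.time x).differentiableOn one_ne_zero, hheat⟩
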